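/- Fix $K\ge 2$, the grid $\mathbf S_K=\{k/(K-1):0\le k\le K-1\}$ of states, $K$ messages $\mathbf M_K$, and a bias $b\in\mathbb R$. *Game.* The state $x$ is uniform on $\mathbf S_K$; the sender observes $x$ and sends a message $m$; the receiver observes $m$ and takes an action $y\in\mathbb R$. Payoffs are $U^S(y,x)=-(y-x-b)^2$ for the sender and $U^R(y,x)=-(y-x)^2$ for the receiver. A sender strategy $\mu$ assigns to each state $x$ a probability vector $\mu(x,\cdot)$ on $\mathbf M_K$. Let $\mathbf{NE}_{CS}$ be the set of sender strategies that are part of a perfect Bayesian equilibrium: there are receiver actions $y(m)$ and beliefs $p(\cdot\mid m)$ such that $\mu(x,\cdot)$ is a best response to $y$ in every state $x$, $y(m)$ is a best response to $p(\cdot\mid m)$ after every message $m$, and $p(\cdot\mid m)$ is given by Bayes' rule for every $m$ sent with positive probability. *Boltzmann Q-learning sender.* Let $\alpha_t>0$, $\tau_t\in(0,1]$, $\varepsilon_t\in(0,1)$ ($t\ge 0$) be non-increasing with $\sum_t\alpha_t=\infty$, $\sum_t\alpha_t^2<\infty$, $\tau_t\to\underline\tau>0$, $\varepsilon_t\to\varepsilon>0$.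 Start from some $Q_0\in\mathbb R^{\mathbf S_K\times\mathbf M_K}$, and put $$\mu_t(x,m)=\frac{e^{Q_t(x,m)/\tau_t}}{\sum_{m'}e^{Q_t(x,m')/\tau_t}},\qquad \bar\mu_t=(1-\varepsilon_t)\mu_t+\frac{\varepsilon_t}{K}.$$ In period $t$, given the past, a state $x_t$ is drawn uniformly from $\mathbf S_K$, and then a message $m_t$ from $\bar\mu_t(x_t,\cdot)$. The receiver plays $y_t(m_t)$, where $y_t(m)=\sum_x x\,\bar\mu_t(x,m)/\sum_x\bar\mu_t(x,m)$ is the mean of the state given $m$ under $\bar\mu_t$. The realized payoff is $u_t=U^S(y_t(m_t),x_t)+\eta_t$, where $\eta_t$ has, conditionally on the past and on $(x_t,m_t)$, mean zero and variance at most some finite constant $\sigma^2$ (for example, $\eta_t$ i.i.d. with mean zero and finite variance, independent of the states and of the randomization over messages). Then $$Q_{t+1}(x_t,m_t)=(1-a_t)\,Q_t(x_t,m_t)+a_t\,u_t,\qquad a_t=\alpha_{n_t(x_t,m_t)},$$ where $n_t(x,m)$ is the number of periods $s<t$ with $(x_s,m_s)=(x,m)$, and $Q_{t+1}=Q_t$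 at all other pairs. Let $\mathbf L(\mu_0)=\bigcap_{t\ge0}\mathrm{cl}\{\mu_\ell:\ell\ge t\}$ be the random set of limit points of the policies. **Theorem 1.** For every $\zeta>0$ there is $\delta>0$, depending only on $\zeta$, $K$ and $b$, such that for every limiting softmax temperature $\underline\tau\in(0,\delta)$ and every limiting exploration rate $\varepsilon\in(0,\delta)$ the following holds for all sequences and noises as above and for every initial $Q_0$ (hence every initial policy $\mu_0$). Almost surely, if $\mathbf L(\mu_0)=\{\mu^*\}$ for a single policy $\mu^*$, then $\mu^*$ is a sender strategy and there is $\mu'\in\mathbf{NE}_{CS}$ with $\|\mu^*-\mu'\|_\infty<\zeta$. -/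

import Mathlib

open MeasureTheory Filter Topology

noncomputable section

namespace CheapTalk

/-- A map assigning a real number to every pair (state, message). States and messages are both
indexed by `Fin K`. The norm on this type is the sup norm over all pairs. -/
abbrev Table (K : ℕ) : Type := Fin K → Fin K → ℝ

/-! ### The discretized quadratic game -/

/-- The `k`-th point (counted from `0`) of the equidistant grid of `K` points in `[0, 1]`. -/
def state (K : ℕ) (k : Fin K) : ℝ := (k : ℝ) / ((K : ℝ) - 1)

/-- The sender's payoff `-(y - x - b)²`. -/
def senderPayoff (b y x : ℝ) : ℝ := -(y - x - b) ^ 2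

/-- The receiver's payoff `-(y - x)²`. -/
def receiverPayoff (y x : ℝ) : ℝ := -(y - x) ^ 2

/-- The set of probability vectors over `Fin K`. -/
def IsProb {K : ℕ} (p : Fin K → ℝ) : Prop := (∀ k, 0 ≤ p k) ∧ ∑ k, p k = 1

/-- The set of mixed sender strategies: `μ x m` is the probability of message `m` in state `x`. -/
def Strategies (K : ℕ) : Set (Table K) := {μ | ∀ x, IsProb (μ x)}

/-- The total probability of message `m` when the state is uniform and the sender plays `μ`. -/
def messageProb {K : ℕ} (μ : Table K) (m : Fin K) : ℝ := ∑ x, (K : ℝ)⁻¹ * μ x m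

/-- Bayes' rule: the conditional probability of state `x` given message `m`, when the state is
uniform and the sender plays `μ` (meaningful when `0 < messageProb μ m`). -/
def posterior {K : ℕ} (μ : Table K) (m x : Fin K) : ℝ := (K : ℝ)⁻¹ * μ x m / messageProb μ m

/-- The conditional expectation of the state given message `m`, when the sender plays `μ`. -/
def posteriorMean {K : ℕ} (μ : Table K) (m : Fin K) : ℝ := ∑ x, posterior μ m x * state K x

/-- `(μ, y, p)` is a perfect Bayesian equilibrium: `μ` is the sender's strategy, `y m` the
receiver's action after message `m`, and `p m` the receiver's belief after message `m`. -/
structure IsPBE {K : ℕ} (b : ℝ) (μ : Table K) (y : Fin K → ℝ) (p : Fin K → Fin K → ℝ) : Prop where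
  strategy : μ ∈ Strategies K
  belief : ∀ m, IsProb (p m)
  /-- in every state the sender's mixed message is optimal against the receiver's actions -/
  sender_optimal : ∀ x m', senderPayoff b (y m') (state K x) ≤
    ∑ m, μ x m * senderPayoff b (y m) (state K x)
  /-- after every message the receiver's action is optimal given the belief -/
  receiver_optimal : ∀ m a, ∑ x, p m x * receiverPayoff a (state K x) ≤
    ∑ x, p m x * receiverPayoff (y m) (state K x)
  /-- beliefs follow Bayes' rule after every message that is sent with positive probability -/
  bayes : ∀ m, 0 < messageProb μ m → p m = posterior μ m

/-- The set of sender strategies that are part of a perfect Bayesian equilibrium. -/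
def NECS (K : ℕ) (b : ℝ) : Set (Table K) := {μ | ∃ y p, IsPBE b μ y p}

/-- The `ζ`-ball of strategies around `ν` in the sup norm. -/
def stratBall {K : ℕ} (ζ : ℝ) (ν : Table K) : Set (Table K) :=
  {μ | μ ∈ Strategies K ∧ ‖μ - ν‖ < ζ}

/-! ### The Boltzmann Q-learning sender -/

/-- Softmax policy at temperature `τ` for the Q-values `Q`. -/
def softmax {K : ℕ} (τ : ℝ) (Q : Table K) : Table K :=
  fun x m => Real.exp (τ⁻¹ * Q x m) / ∑ m', Real.exp (τ⁻¹ * Q x m')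

/-- The full messaging policy: softmax mixed with uniform exploration of weight `ε`. -/
def fullPolicy {K : ℕ} (τ ε : ℝ) (Q : Table K) : Table K :=
  fun x m => (1 - ε) * softmax τ Q x m + ε * (1 / (K : ℝ))

/-- The three parameter sequences: learning rates, temperatures, exploration rates. -/
structure Schedule where
  α : ℕ → ℝ
  τ : ℕ → ℝ
  ε : ℕ → ℝ

/-- The assumptions on the parameter sequences, with limiting temperature `τlim` and limiting
exploration rate `εlim`. -/
structure Schedule.Admissible (S : Schedule) (τlim εlim : ℝ) : Prop where
  α_pos : ∀ t, 0 < S.α t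
  α_antitone : Antitone S.α
  α_sum : ¬ Summable S.α
  α_sq_sum : Summable fun t => S.α t ^ 2
  τ_mem : ∀ t, 0 < S.τ t ∧ S.τ t ≤ 1
  τ_antitone : Antitone S.τ
  τ_lim : Tendsto S.τ atTop (𝓝 τlim)
  ε_mem : ∀ t, 0 < S.ε t ∧ S.ε t < 1
  ε_antitone : Antitone S.ε
  ε_lim : Tendsto S.ε atTop (𝓝 εlim)

/-- The number of visits to the pair `(x, m)` strictly before period `t`, along the path of
states `xs` and messages `ms`. -/
def visits {K : ℕ} (xs ms : ℕ → Fin K) (t : ℕ) (x m : Fin K) : ℕ :=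
  ((Finset.range t).filter fun s => xs s = x ∧ ms s = m).card

/-- The Q-values along a path of states `xs`, messages `ms` and payoff noises `η`, started at `Q₀`.
In period `t` the receiver's action after the message is the posterior mean given the full policy
of that period, and only the entry of the realized pair is updated, with a step size that advances
only when that pair is visited. -/
def qPath {K : ℕ} (b : ℝ) (S : Schedule) (Q₀ : Table K) (xs ms : ℕ → Fin K) (η : ℕ → ℝ) :
    ℕ → Table K
  | 0 => Q₀
  | t + 1 => fun x m =>
      let Q := qPath b S Q₀ xs ms η t
      let y := posteriorMean (fullPolicy (S.τ t) (S.ε t) Q) m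
      let u := senderPayoff b y (state K x) + η t
      let a := S.α (visits xs ms t x m)
      if xs t = x ∧ ms t = m then (1 - a) * Q x m + a * u else Q x m

/-- The softmax policies `μ_t` (without exploration) along a path. -/
def policyPath {K : ℕ} (b : ℝ) (S : Schedule) (Q₀ : Table K) (xs ms : ℕ → Fin K) (η : ℕ → ℝ)
    (t : ℕ) : Table K :=
  softmax (S.τ t) (qPath b S Q₀ xs ms η t)

/-- The set of limit points of a sequence of policies. -/
def limitSet {K : ℕ} (μ : ℕ → Table K) : Set (Table K) :=
  ⋂ t : ℕ, closure {ν | ∃ l, t ≤ l ∧ ν = μ l}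

/-- The random states `X t`, messages `M t` and payoff noises `η t` are those of the Boltzmann
Q-learning sender started at `Q₀`: `ℱ t` is the information before period `t`. -/
structure IsBoltzmannRun {K : ℕ} (b : ℝ) (S : Schedule) (Q₀ : Table K)
    {Ω : Type*} [mΩ : MeasurableSpace Ω] (P : Measure Ω) (ℱ : Filtration ℕ mΩ)
    (X M : ℕ → Ω → Fin K) (η : ℕ → Ω → ℝ) : Prop where
  measurable_state : ∀ t, Measurable[ℱ (t + 1)] (X t)
  measurable_message : ∀ t, Measurable[ℱ (t + 1)] (M t)
  measurable_noise : ∀ t, Measurable[ℱ (t + 1)] (η t)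
  /-- given the past, the state is uniform and, given the state, the message is drawn from the
  current full policy -/
  cond_law : ∀ t x m,
    P[{ω | X t ω = x ∧ M t ω = m}.indicator (fun _ => (1 : ℝ)) | ℱ t] =ᵐ[P] fun ω =>
      (1 / (K : ℝ)) * fullPolicy (S.τ t) (S.ε t)
        (qPath b S Q₀ (fun s => X s ω) (fun s => M s ω) (fun s => η s ω) t) x m
  /-- given the past and the current state and message, the noise has mean zero and a variance
  that is bounded uniformly over time -/
  noise_memLp : ∀ t, MemLp (η t) 2 P
  noise_mean : ∀ t,
    P[η t | ℱ t ⊔ MeasurableSpace.comap (fun ω => (X t ω, M t ω)) inferInstance] =ᵐ[P] 0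
  noise_var : ∃ σsq : ℝ, ∀ t,
    P[fun ω => η t ω ^ 2 | ℱ t ⊔ MeasurableSpace.comap (fun ω => (X t ω, M t ω)) inferInstance]
      ≤ᵐ[P] fun _ => σsq

end CheapTalk

end

namespace CheapTalk

/-! ### Deterministic stochastic approximation -/

/-! Convergence is a hypothesis, so no stability analysis is needed. By compactness, a single limit
point means that the policies converge. Exploration stays bounded away from zero, so every pair
recurs almost surely and every message keeps positive probability in the limit. Hence posterior
means, and with them expected payoffs, converge. Each Q-value averages payoffs with steps that have
divergent sum and summable squares along the visits of its pair. It therefore converges to the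
limiting payoff, and `μstar` is a softmax fixed point at the limiting temperature and exploration
rate (`limit_eq_softmax`).

The rest is deterministic: as temperature and exploration vanish, softmax fixed points accumulate
only at equilibria, with limits of posteriors as off-path beliefs. Compactness makes this uniform
(`exists_softmax_fixed_points_near_NECS`), so `δ` depends on neither schedule nor noise. -/

lemma tendsto_zero_of_averaging {v c e : ℕ → ℝ} (hc : ∀ᶠ t in atTop, 0 ≤ c t ∧ c t ≤ 1)
    (hdiv : Tendsto (fun n => ∑ t ∈ Finset.range n, c t) atTop atTop)
    (he : Tendsto e atTop (𝓝 0)) (hv : ∀ t, v (t + 1) = (1 - c t) * v t + c t * e t) :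
    Tendsto v atTop (𝓝 0) := by
  rw [Metric.tendsto_atTop]
  intro r hr
  have he' : ∀ᶠ t in atTop, |e t| < r / 2 := by
    have := he.abs
    rw [abs_zero] at this
    exact this.eventually_lt_const (by linarith)
  obtain ⟨T, hT⟩ := eventually_atTop.1 (hc.and he')
  -- The initial error contracts by `1 - c ≤ exp (-c)` at each step, while the perturbations enter
  -- as convex averages and so never exceed `r / 2`.
  have key : ∀ n, |v (n + T)| ≤ r / 2 +
      |v T| * Real.exp (-∑ k ∈ Finset.range n, c (k + T)) := by
    intro n
    induction n with
    | zero => simpa using (half_pos hr).le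
    | succ n ih =>
      obtain ⟨⟨h0, h1⟩, h2⟩ := hT (n + T) (by omega)
      rw [show n + 1 + T = n + T + 1 by ring, hv, Finset.sum_range_succ, neg_add, Real.exp_add]
      set E := |v T| * Real.exp (-∑ k ∈ Finset.range n, c (k + T))
      have hE : 0 ≤ E := by positivity
      have hexp : 1 - c (n + T) ≤ Real.exp (-c (n + T)) := by
        have := Real.add_one_le_exp (-c (n + T)); linarith
      calc |(1 - c (n + T)) * v (n + T) + c (n + T) * e (n + T)|
          ≤ |(1 - c (n + T)) * v (n + T)| + |c (n + T) * e (n + T)| := abs_add_le _ _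
        _ = (1 - c (n + T)) * |v (n + T)| + c (n + T) * |e (n + T)| := by
          rw [abs_mul, abs_mul, abs_of_nonneg h0, abs_of_nonneg (by linarith : 0 ≤ 1 - c (n + T))]
        _ ≤ (1 - c (n + T)) * (r / 2 + E) + c (n + T) * (r / 2) := by gcongr
        _ = r / 2 + E * (1 - c (n + T)) := by ring
        _ ≤ r / 2 + E * Real.exp (-c (n + T)) := by gcongr
        _ = _ := by rw [← mul_assoc]
  have hS : Tendsto (fun n => ∑ k ∈ Finset.range n, c (k + T)) atTop atTop := by
    have h1 : Tendsto (fun n => -(∑ t ∈ Finset.range T, c t) + ∑ t ∈ Finset.range (n + T), c t)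
        atTop atTop := tendsto_atTop_add_const_left _ _ ((tendsto_add_atTop_iff_nat T).2 hdiv)
    refine h1.congr fun n => ?_
    rw [add_comm n T, Finset.sum_range_add, neg_add_cancel_left]
    simp only [add_comm T]
  have hlim : Tendsto (fun n => r / 2 +
      |v T| * Real.exp (-∑ k ∈ Finset.range n, c (k + T))) atTop (𝓝 (r / 2 + |v T| * 0)) :=
    ((Real.tendsto_exp_neg_atTop_nhds_zero.comp hS).const_mul _).const_add _
  rw [mul_zero, add_zero] at hlim
  obtain ⟨N, hN⟩ := eventually_atTop.1 (hlim.eventually_lt_const (by linarith : r / 2 < r))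
  refine ⟨N + T, fun n hn => ?_⟩
  have h1 := hN (n - T) (by omega)
  have h2 := key (n - T)
  rw [Nat.sub_add_cancel (by omega)] at h2
  rw [Real.dist_eq, sub_zero]
  linarith

/-- Adding back the tail of the convergent noise series, i.e. subtracting `N n - z` from `q n`,
leaves a noiseless recursion with vanishing perturbation. -/
lemma tendsto_of_noisy_averaging {q c r η : ℕ → ℝ} {l : ℝ}
    (hc : ∀ᶠ t in atTop, 0 ≤ c t ∧ c t ≤ 1)
    (hdiv : Tendsto (fun n => ∑ t ∈ Finset.range n, c t) atTop atTop)
    (hr : Tendsto r atTop (𝓝 l))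
    (hη : ∃ z, Tendsto (fun n => ∑ t ∈ Finset.range n, c t * η t) atTop (𝓝 z))
    (hq : ∀ t, q (t + 1) = (1 - c t) * q t + c t * (r t + η t)) :
    Tendsto q atTop (𝓝 l) := by
  obtain ⟨z, hz⟩ := hη
  set N : ℕ → ℝ := fun n => ∑ t ∈ Finset.range n, c t * η t with hN
  have hNz : Tendsto (fun n => N n - z) atTop (𝓝 0) := by simpa using hz.sub_const z
  have hv : Tendsto (fun n => q n - (N n - z) - l) atTop (𝓝 0) := by
    refine tendsto_zero_of_averaging (e := fun n => r n - l - (N n - z)) hc hdiv ?_ fun t => ?_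
    · simpa using (hr.sub_const l).sub hNz
    · have : N (t + 1) = N t + c t * η t := Finset.sum_range_succ _ _
      rw [hq, this]; ring
  simpa [sub_right_comm] using (hv.add hNz).add_const l

/-! ### Visits and step sizes -/

/-- The step size applied to the pair `(x, m)` in period `t`: zero unless the pair is visited. -/
noncomputable def stepSize {K : ℕ} (S : Schedule) (xs ms : ℕ → Fin K) (x m : Fin K) (t : ℕ) : ℝ :=
  if xs t = x ∧ ms t = m then S.α (visits xs ms t x m) else 0

lemma visits_succ {K : ℕ} (xs ms : ℕ → Fin K) (t : ℕ) (x m : Fin K) :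
    visits xs ms (t + 1) x m = visits xs ms t x m + if xs t = x ∧ ms t = m then 1 else 0 := by
  simp only [visits, Finset.card_filter, Finset.sum_range_succ]

/-- This passes from calendar time to the pair's own visit clock. It is used with the identity for
divergence and with the square for boundedness. -/
lemma sum_stepSize {K : ℕ} (S : Schedule) (xs ms : ℕ → Fin K) (x m : Fin K) (f : ℝ → ℝ)
    (hf : f 0 = 0) (n : ℕ) :
    ∑ t ∈ Finset.range n, f (stepSize S xs ms x m t) =
      ∑ k ∈ Finset.range (visits xs ms n x m), f (S.α k) := by
  induction n with
  | zero => simp [visits]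
  | succ n ih =>
    rw [Finset.sum_range_succ, ih, visits_succ, stepSize]
    split_ifs with h
    · rw [Finset.sum_range_succ]
    · rw [hf, add_zero, add_zero]

lemma tendsto_visits {K : ℕ} {xs ms : ℕ → Fin K} {x m : Fin K}
    (h : ∃ᶠ t in atTop, xs t = x ∧ ms t = m) :
    Tendsto (fun t => visits xs ms t x m) atTop atTop := by
  have hmono : Monotone fun t => visits xs ms t x m :=
    monotone_nat_of_le_succ fun t => by rw [visits_succ]; omega
  refine tendsto_atTop_atTop_of_monotone hmono fun b => ?_
  induction b with
  | zero => exact ⟨0, Nat.zero_le _⟩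
  | succ b ih =>
    obtain ⟨a, ha⟩ := ih
    obtain ⟨t, hat, ht⟩ := frequently_atTop.1 h a
    refine ⟨t + 1, ?_⟩
    have : visits xs ms a x m ≤ visits xs ms t x m := hmono hat
    rw [visits_succ, if_pos ht]
    omega

lemma stepSize_nonneg {K : ℕ} {S : Schedule} {τlim εlim : ℝ} (hS : S.Admissible τlim εlim)
    (xs ms : ℕ → Fin K) (x m : Fin K) (t : ℕ) : 0 ≤ stepSize S xs ms x m t := by
  rw [stepSize]
  split_ifs
  exacts [(hS.α_pos _).le, le_rfl]

lemma stepSize_le {K : ℕ} {S : Schedule} {τlim εlim : ℝ} (hS : S.Admissible τlim εlim)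
    (xs ms : ℕ → Fin K) (x m : Fin K) (t : ℕ) : stepSize S xs ms x m t ≤ S.α 0 := by
  rw [stepSize]
  split_ifs
  exacts [hS.α_antitone (Nat.zero_le _), (hS.α_pos _).le]

lemma tendsto_sum_stepSize {K : ℕ} {S : Schedule} {τlim εlim : ℝ} (hS : S.Admissible τlim εlim)
    {xs ms : ℕ → Fin K} {x m : Fin K} (h : ∃ᶠ t in atTop, xs t = x ∧ ms t = m) :
    Tendsto (fun n => ∑ t ∈ Finset.range n, stepSize S xs ms x m t) atTop atTop := by
  have := (not_summable_iff_tendsto_nat_atTop_of_nonneg fun n => (hS.α_pos n).le).1 hS.α_sum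
  exact (this.comp (tendsto_visits h)).congr fun n => (sum_stepSize S xs ms x m id rfl n).symm

lemma eventually_stepSize_mem {K : ℕ} {S : Schedule} {τlim εlim : ℝ}
    (hS : S.Admissible τlim εlim) {xs ms : ℕ → Fin K} {x m : Fin K}
    (h : ∃ᶠ t in atTop, xs t = x ∧ ms t = m) :
    ∀ᶠ t in atTop, 0 ≤ stepSize S xs ms x m t ∧ stepSize S xs ms x m t ≤ 1 := by
  -- Early learning rates may exceed one; square summability rules this out eventually.
  have h1 : ∀ᶠ n in atTop, S.α n ≤ 1 := by
    filter_upwards [hS.α_sq_sum.tendsto_atTop_zero.eventually_lt_const zero_lt_one] with n hn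
    nlinarith [hS.α_pos n]
  filter_upwards [(tendsto_visits h).eventually h1] with t ht
  refine ⟨stepSize_nonneg hS xs ms x m t, ?_⟩
  rw [stepSize]
  split_ifs
  exacts [ht, zero_le_one]

lemma sum_sq_stepSize_le {K : ℕ} {S : Schedule} {τlim εlim : ℝ} (hS : S.Admissible τlim εlim)
    (xs ms : ℕ → Fin K) (x m : Fin K) (n : ℕ) :
    ∑ t ∈ Finset.range n, stepSize S xs ms x m t ^ 2 ≤ ∑' k, S.α k ^ 2 := by
  rw [sum_stepSize S xs ms x m (· ^ 2) (by simp)]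
  exact hS.α_sq_sum.sum_le_tsum _ fun _ _ => sq_nonneg _

/-- With step zero at unvisited pairs, the asynchronous update becomes one averaging recursion per
pair, valid in every period. -/
lemma qPath_succ {K : ℕ} (b : ℝ) (S : Schedule) (Q₀ : Table K) (xs ms : ℕ → Fin K) (η : ℕ → ℝ)
    (t : ℕ) (x m : Fin K) :
    qPath b S Q₀ xs ms η (t + 1) x m =
      (1 - stepSize S xs ms x m t) * qPath b S Q₀ xs ms η t x m + stepSize S xs ms x m t *
        (senderPayoff b (posteriorMean
          (fullPolicy (S.τ t) (S.ε t) (qPath b S Q₀ xs ms η t)) m) (state K x) + η t) := by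
  by_cases h : xs t = x ∧ ms t = m
  · simp only [qPath, stepSize, if_pos h]
  · simp only [qPath, stepSize, if_neg h]
    ring

/-! ### Strategies, softmax and posteriors -/

lemma isCompact_strategies (K : ℕ) : IsCompact (Strategies K) := by
  have : Strategies K = Set.univ.pi fun _ => stdSimplex ℝ (Fin K) := by
    ext μ
    simp [Strategies, IsProb, stdSimplex]
  rw [this]
  exact isCompact_univ_pi fun _ => isCompact_stdSimplex ℝ (Fin K)

lemma softmax_pos {K : ℕ} (τ : ℝ) (Q : Table K) (x m : Fin K) : 0 < softmax τ Q x m :=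
  div_pos (Real.exp_pos _) (Finset.sum_pos (fun _ _ => Real.exp_pos _) ⟨m, Finset.mem_univ m⟩)

lemma softmax_mem_strategies {K : ℕ} (τ : ℝ) (Q : Table K) : softmax τ Q ∈ Strategies K := by
  refine fun x => ⟨fun m => (softmax_pos τ Q x m).le, ?_⟩
  simp only [softmax]
  rw [← Finset.sum_div]
  exact div_self (Finset.sum_pos (fun _ _ => Real.exp_pos _) ⟨x, Finset.mem_univ x⟩).ne'

/-- A strategy mixed with uniform exploration of weight `ε`. -/
noncomputable def explore {K : ℕ} (ε : ℝ) (μ : Table K) : Table K :=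
  fun x m => (1 - ε) * μ x m + ε * (1 / (K : ℝ))

lemma le_explore {K : ℕ} {ε : ℝ} (h1 : ε ≤ 1) {μ : Table K} (hμ : μ ∈ Strategies K)
    (x m : Fin K) : ε * (1 / (K : ℝ)) ≤ explore ε μ x m :=
  le_add_of_nonneg_left (mul_nonneg (by linarith) ((hμ x).1 m))

lemma explore_pos {K : ℕ} {ε : ℝ} (h0 : 0 < ε) (h1 : ε ≤ 1) {μ : Table K} (hμ : μ ∈ Strategies K)
    (x m : Fin K) : 0 < explore ε μ x m := by
  have : (0 : ℝ) < K := Nat.cast_pos.2 x.pos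
  exact lt_of_lt_of_le (by positivity) (le_explore h1 hμ x m)

lemma messageProb_pos {K : ℕ} {μ : Table K} {m : Fin K} (h : ∀ x, 0 < μ x m) :
    0 < messageProb μ m := by
  have : (0 : ℝ) < K := Nat.cast_pos.2 m.pos
  exact Finset.sum_pos (fun x _ => mul_pos (inv_pos.2 this) (h x)) ⟨m, Finset.mem_univ m⟩

lemma isProb_posterior {K : ℕ} {μ : Table K} {m : Fin K} (h : ∀ x, 0 < μ x m) :
    IsProb (posterior μ m) := by
  have hm := messageProb_pos h
  refine ⟨fun x => ?_, ?_⟩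
  · have := h x
    unfold posterior
    positivity
  · simp only [posterior]
    rw [← Finset.sum_div]
    exact div_self hm.ne'

/-- Positivity is required only for the one message in the limit, so the lemma also applies on path
when exploration vanishes. -/
lemma tendsto_posterior {K : ℕ} {ι : Type*} {l : Filter ι} {ν : ι → Table K} {μ : Table K}
    (hν : Tendsto ν l (𝓝 μ)) {m : Fin K} (hm : 0 < messageProb μ m) (x : Fin K) :
    Tendsto (fun i => posterior (ν i) m x) l (𝓝 (posterior μ m x)) := by
  have h : ∀ x m, Tendsto (fun i => ν i x m) l (𝓝 (μ x m)) := fun x m =>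
    tendsto_pi_nhds.1 (tendsto_pi_nhds.1 hν x) m
  exact ((h x m).const_mul _).div
    (tendsto_finsetSum _ fun x _ => (h x m).const_mul _) hm.ne'

lemma tendsto_explore {K : ℕ} {ι : Type*} {l : Filter ι} {ν : ι → Table K} {μ : Table K}
    (hν : Tendsto ν l (𝓝 μ)) {e : ι → ℝ} {ε : ℝ} (he : Tendsto e l (𝓝 ε)) :
    Tendsto (fun i => explore (e i) (ν i)) l (𝓝 (explore ε μ)) := by
  refine tendsto_pi_nhds.2 fun x => tendsto_pi_nhds.2 fun m => ?_
  exact ((he.const_sub 1).mul (tendsto_pi_nhds.1 (tendsto_pi_nhds.1 hν x) m)).add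
    (he.mul_const _)

/-- The sender's payoffs of all pairs when the receiver best responds to the strategy `ν`. -/
noncomputable def payoffTable {K : ℕ} (b : ℝ) (ν : Table K) : Table K :=
  fun x m => senderPayoff b (posteriorMean ν m) (state K x)

lemma tendsto_payoffTable {K : ℕ} (b : ℝ) {ι : Type*} {l : Filter ι} {ν : ι → Table K}
    {μ : Table K} (hν : Tendsto ν l (𝓝 μ)) (hμ : ∀ x m, 0 < μ x m) (x m : Fin K) :
    Tendsto (fun i => payoffTable b (ν i) x m) l (𝓝 (payoffTable b μ x m)) := by
  have h : Tendsto (fun i => posteriorMean (ν i) m) l (𝓝 (posteriorMean μ m)) :=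
    tendsto_finsetSum _ fun z _ =>
      (tendsto_posterior hν (messageProb_pos fun x => hμ x m) z).mul_const _
  exact (((h.sub_const _).sub_const _).pow 2).neg

lemma tendsto_softmax {K : ℕ} {ι : Type*} {l : Filter ι} {Q : ι → Table K} {Qlim : Table K}
    (hQ : ∀ x m, Tendsto (fun i => Q i x m) l (𝓝 (Qlim x m))) {τ : ι → ℝ} {τlim : ℝ}
    (hτ : Tendsto τ l (𝓝 τlim)) (h0 : τlim ≠ 0) :
    Tendsto (fun i => softmax (τ i) (Q i)) l (𝓝 (softmax τlim Qlim)) := by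
  refine tendsto_pi_nhds.2 fun x => tendsto_pi_nhds.2 fun m => ?_
  have h : ∀ m, Tendsto (fun i => Real.exp ((τ i)⁻¹ * Q i x m)) l
      (𝓝 (Real.exp (τlim⁻¹ * Qlim x m))) := fun m =>
    (Real.continuous_exp.tendsto _).comp ((hτ.inv₀ h0).mul (hQ x m))
  exact (h m).div (tendsto_finsetSum _ fun m _ => h m)
    (Finset.sum_pos (fun _ _ => Real.exp_pos _) ⟨m, Finset.mem_univ m⟩).ne'

/-- Softmax is optimal up to an error that vanishes with the temperature. -/
lemma le_sum_softmax_mul {K : ℕ} {τ : ℝ} (hτ : 0 < τ) (Q : Table K) (x m' : Fin K) :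
    Q x m' ≤ ∑ m, softmax τ Q x m * Q x m + K * τ := by
  -- Each message contributes regret at most `τ`: keeping only the term `m'` of the denominator
  -- bounds its weight by `exp (-d / τ)`, and `s * exp (-s) ≤ 1` with `s = d / τ`.
  have h : ∀ m, softmax τ Q x m * (Q x m' - Q x m) ≤ τ := by
    intro m
    set d := Q x m' - Q x m with hd
    have hp := softmax_pos τ Q x m
    rcases le_or_gt d 0 with h0 | h0
    · exact (mul_nonpos_of_nonneg_of_nonpos hp.le h0).trans hτ.le
    have h1 : softmax τ Q x m ≤ Real.exp (-(τ⁻¹ * d)) := by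
      rw [softmax, div_le_iff₀ (Finset.sum_pos (fun _ _ => Real.exp_pos _) ⟨m, Finset.mem_univ m⟩)]
      calc Real.exp (τ⁻¹ * Q x m) = Real.exp (-(τ⁻¹ * d)) * Real.exp (τ⁻¹ * Q x m') := by
            rw [← Real.exp_add, hd]; ring_nf
        _ ≤ _ := by
          gcongr
          exact Finset.single_le_sum (f := fun m' => Real.exp (τ⁻¹ * Q x m'))
            (fun _ _ => (Real.exp_pos _).le) (Finset.mem_univ m')
    have h2 : τ⁻¹ * d ≤ Real.exp (τ⁻¹ * d) := by
      have := Real.add_one_le_exp (τ⁻¹ * d); linarith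
    calc softmax τ Q x m * d ≤ Real.exp (-(τ⁻¹ * d)) * d := by gcongr
      _ = τ * (Real.exp (-(τ⁻¹ * d)) * (τ⁻¹ * d)) := by field_simp
      _ ≤ τ * (Real.exp (-(τ⁻¹ * d)) * Real.exp (τ⁻¹ * d)) := by gcongr
      _ = τ := by rw [← Real.exp_add]; simp
  have hs := Finset.sum_le_sum fun m (_ : m ∈ Finset.univ) => h m
  simp only [mul_sub, Finset.sum_sub_distrib, ← Finset.sum_mul] at hs
  rw [(softmax_mem_strategies τ Q x).2] at hs
  simp only [Finset.sum_const, Finset.card_univ, Fintype.card_fin, nsmul_eq_mul] at hs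
  linarith

lemma receiver_mean_optimal {K : ℕ} {p : Fin K → ℝ} (hp : IsProb p) (a : ℝ) :
    ∑ x, p x * receiverPayoff a (state K x) ≤
      ∑ x, p x * receiverPayoff (∑ z, p z * state K z) (state K x) := by
  set y := ∑ z, p z * state K z with hy
  -- Bias-variance decomposition: deviating from the mean costs exactly the squared deviation.
  have h : ∑ x, p x * receiverPayoff y (state K x) - ∑ x, p x * receiverPayoff a (state K x)
      = (a - y) ^ 2 := by
    calc _ = ∑ x, ((a ^ 2 - y ^ 2) * p x - 2 * (a - y) * (p x * state K x)) := by
            rw [← Finset.sum_sub_distrib]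
            exact Finset.sum_congr rfl fun x _ => by simp only [receiverPayoff]; ring
      _ = (a ^ 2 - y ^ 2) * 1 - 2 * (a - y) * y := by
            rw [Finset.sum_sub_distrib, ← Finset.mul_sum, ← Finset.mul_sum, hp.2]
      _ = _ := by ring
  nlinarith [sq_nonneg (a - y)]

/-- Limits of softmax fixed points, as temperature and exploration vanish, are equilibria. -/
lemma mem_NECS_of_tendsto {K : ℕ} {b : ℝ} {τ ε : ℕ → ℝ} {μ p : ℕ → Table K} {μlim plim : Table K}
    (hτ : ∀ n, 0 < τ n) (hτ0 : Tendsto τ atTop (𝓝 0)) (hε0 : Tendsto ε atTop (𝓝 0))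
    (hfix : ∀ n, μ n = softmax (τ n) (payoffTable b (explore (ε n) (μ n))))
    (hp : ∀ n, p n = posterior (explore (ε n) (μ n)))
    (hμ : Tendsto μ atTop (𝓝 μlim)) (hpl : Tendsto p atTop (𝓝 plim))
    (hμS : μlim ∈ Strategies K) (hpS : plim ∈ Strategies K) : μlim ∈ NECS K b := by
  have hpm : ∀ m x, Tendsto (fun n => p n m x) atTop (𝓝 (plim m x)) := fun m x =>
    tendsto_pi_nhds.1 (tendsto_pi_nhds.1 hpl m) x
  have hμm : ∀ m x, Tendsto (fun n => μ n m x) atTop (𝓝 (μlim m x)) := fun m x =>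
    tendsto_pi_nhds.1 (tendsto_pi_nhds.1 hμ m) x
  have hU : ∀ x m, Tendsto (fun n => payoffTable b (explore (ε n) (μ n)) x m) atTop
      (𝓝 (senderPayoff b (∑ z, plim m z * state K z) (state K x))) := by
    intro x m
    have hy : Tendsto (fun n => ∑ z, p n m z * state K z) atTop
        (𝓝 (∑ z, plim m z * state K z)) :=
      tendsto_finsetSum _ fun z _ => (hpm m z).mul_const _
    refine ((((hy.sub_const (state K x)).sub_const b).pow 2).neg).congr fun n => ?_
    rw [hp]
    rfl
  -- The limits of the posteriors serve as beliefs, including after messages that `μlim` never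
  -- sends.
  refine ⟨fun m => ∑ z, plim m z * state K z, plim, hμS, hpS, fun x m' => ?_,
    fun m a => receiver_mean_optimal (hpS m) a, fun m hm => ?_⟩
  · have hR : Tendsto (fun n => ∑ m, μ n x m * payoffTable b (explore (ε n) (μ n)) x m + K * τ n)
        atTop (𝓝 (∑ m, μlim x m *
          senderPayoff b (∑ z, plim m z * state K z) (state K x) + K * 0)) :=
      (tendsto_finsetSum _ fun m _ => (hμm x m).mul (hU x m)).add (hτ0.const_mul _)
    rw [mul_zero, add_zero] at hR
    refine le_of_tendsto_of_tendsto' (hU x m') hR fun n => ?_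
    have := le_sum_softmax_mul (hτ n) (payoffTable b (explore (ε n) (μ n))) x m'
    rwa [← hfix n] at this
  -- On path the posterior is continuous even at zero exploration, so uniqueness of limits
  -- identifies `plim m` with Bayes' rule.
  · have hlim : Tendsto (fun n => explore (ε n) (μ n)) atTop (𝓝 μlim) := by
      have := tendsto_explore hμ hε0
      have h0 : explore 0 μlim = μlim := by ext x m; simp [explore]
      rwa [h0] at this
    ext x
    refine tendsto_nhds_unique (hpm m x) ((tendsto_posterior hlim hm x).congr fun n => ?_)
    rw [hp]

/-- For low temperature and exploration, softmax fixed points are close to equilibria. -/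
lemma exists_softmax_fixed_points_near_NECS (K : ℕ) (b : ℝ) {ζ : ℝ} (hζ : 0 < ζ) :
    ∃ δ : ℝ, 0 < δ ∧ ∀ τ ε : ℝ, 0 < τ → τ < δ → 0 < ε → ε < δ → ∀ μ : Table K,
      μ = softmax τ (payoffTable b (explore ε μ)) → ∃ μ' ∈ NECS K b, μ ∈ stratBall ζ μ' := by
  by_contra! hcon
  choose τ ε hτ0 hτ hε0 hε μ hfix hfar using
    fun n : ℕ => hcon (1 / ((n : ℝ) + 1)) Nat.one_div_pos_of_nat
  have hdiv := tendsto_one_div_add_atTop_nhds_zero_nat (𝕜 := ℝ)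
  have hτl : Tendsto τ atTop (𝓝 0) := squeeze_zero (fun n => (hτ0 n).le) (fun n => (hτ n).le) hdiv
  have hεl : Tendsto ε atTop (𝓝 0) := squeeze_zero (fun n => (hε0 n).le) (fun n => (hε n).le) hdiv
  have hμS : ∀ n, μ n ∈ Strategies K := fun n => by
    rw [hfix n]; exact softmax_mem_strategies _ _
  have hε1 : ∀ n, ε n ≤ 1 := fun n => by
    refine (hε n).le.trans ?_
    rw [div_le_one (by positivity)]
    linarith [(Nat.cast_nonneg n : (0 : ℝ) ≤ n)]
  -- Beliefs must converge along the same subsequence. A belief table, indexed by message and then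
  -- state, also has probability vectors as rows, so it lies in the same compact set.
  obtain ⟨⟨μlim, plim⟩, ⟨hμl, hpl⟩, φ, hφ, hlim⟩ :=
    ((isCompact_strategies K).prod (isCompact_strategies K)).tendsto_subseq
      (x := fun n => (μ n, posterior (explore (ε n) (μ n))))
      fun n => ⟨hμS n, fun m => isProb_posterior fun x => explore_pos (hε0 n) (hε1 n) (hμS n) x m⟩
  have hμlim : Tendsto (fun n => μ (φ n)) atTop (𝓝 μlim) := (continuous_fst.tendsto _).comp hlim
  have hNE : μlim ∈ NECS K b :=
    mem_NECS_of_tendsto (fun n => hτ0 (φ n)) (hτl.comp hφ.tendsto_atTop)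
      (hεl.comp hφ.tendsto_atTop) (fun n => hfix (φ n)) (fun _ => rfl) hμlim
      ((continuous_snd.tendsto _).comp hlim) hμl hpl
  obtain ⟨n, hn⟩ := (hμlim.eventually (Metric.ball_mem_nhds μlim hζ)).exists
  exact hfar (φ n) μlim hNE ⟨hμS _, by rwa [← dist_eq_norm]⟩

/-! ### Pathwise convergence -/

/-- Every cluster point lies in `limitSet`, and a sequence in a compact set with at most one cluster
point converges to it. -/
lemma tendsto_of_limitSet_eq_singleton {K : ℕ} {μ : ℕ → Table K} {μstar : Table K}
    (hμ : ∀ t, μ t ∈ Strategies K) (h : limitSet μ = {μstar}) :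
    Tendsto μ atTop (𝓝 μstar) := by
  refine (isCompact_strategies K).tendsto_nhds_of_unique_mapClusterPt
    (Eventually.of_forall hμ) fun ν _ hν => ?_
  rw [← Set.mem_singleton_iff, ← h, limitSet, Set.mem_iInter]
  intro t
  rw [mem_closure_iff_nhds]
  intro s hs
  obtain ⟨l, hl, hls⟩ := frequently_atTop.1 (mapClusterPt_iff_frequently.1 hν s hs) t
  exact ⟨μ l, hls, l, hl, rfl⟩

/-- If the policies of a path converge, every pair recurs and the accumulated noise converges,
then the limit policy is a softmax fixed point. -/
lemma limit_eq_softmax {K : ℕ} {b : ℝ} {S : Schedule} {τlim εlim : ℝ}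
    (hS : S.Admissible τlim εlim) (hτ : 0 < τlim) (hε : 0 < εlim) {Q₀ : Table K}
    {xs ms : ℕ → Fin K} {η : ℕ → ℝ} (hvis : ∀ x m, ∃ᶠ t in atTop, xs t = x ∧ ms t = m)
    (hη : ∀ x m, ∃ z, Tendsto
      (fun n => ∑ t ∈ Finset.range n, stepSize S xs ms x m t * η t) atTop (𝓝 z))
    {μstar : Table K} (h : limitSet (policyPath b S Q₀ xs ms η) = {μstar}) :
    μstar = softmax τlim (payoffTable b (explore εlim μstar)) := by
  have hmem : ∀ t, policyPath b S Q₀ xs ms η t ∈ Strategies K := fun t =>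
    softmax_mem_strategies _ _
  have hμ := tendsto_of_limitSet_eq_singleton hmem h
  have hstar : μstar ∈ Strategies K :=
    (isCompact_strategies K).isClosed.mem_of_tendsto hμ (Eventually.of_forall hmem)
  have hε1 : εlim ≤ 1 := le_of_tendsto' hS.ε_lim fun t => (hS.ε_mem t).2.le
  -- Positive limiting exploration is essential here: it keeps every message on path, where the
  -- posterior mean is continuous.
  have hr := tendsto_payoffTable b (tendsto_explore hμ hS.ε_lim) (explore_pos hε hε1 hstar)
  have hQ : ∀ x m, Tendsto (fun t => qPath b S Q₀ xs ms η t x m) atTop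
      (𝓝 (payoffTable b (explore εlim μstar) x m)) := fun x m =>
    tendsto_of_noisy_averaging (eventually_stepSize_mem hS (hvis x m))
      (tendsto_sum_stepSize hS (hvis x m)) (hr x m) (hη x m)
      fun t => qPath_succ b S Q₀ xs ms η t x m
  exact tendsto_nhds_unique hμ (tendsto_softmax hQ hS.τ_lim hτ.ne')

/-! ### Almost sure properties of a run -/

/-- Sums of martingale differences weighted by conditionally known factors with bounded total
squares converge almost surely. -/
lemma ae_exists_tendsto_sum_mul {Ω : Type*} {mΩ : MeasurableSpace Ω} {P : Measure Ω}
    [IsProbabilityMeasure P] {ℱ : Filtration ℕ mΩ} {𝒢 : ℕ → MeasurableSpace Ω}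
    (hℱ𝒢 : ∀ t, ℱ t ≤ 𝒢 t) (h𝒢 : ∀ t, 𝒢 t ≤ ℱ (t + 1)) {c η : ℕ → Ω → ℝ} {C B σsq : ℝ}
    (hc : ∀ t, StronglyMeasurable[𝒢 t] (c t)) (hcC : ∀ t ω, |c t ω| ≤ C)
    (hcB : ∀ n ω, ∑ t ∈ Finset.range n, c t ω ^ 2 ≤ B)
    (hη : ∀ t, StronglyMeasurable[ℱ (t + 1)] (η t)) (hη2 : ∀ t, MemLp (η t) 2 P)
    (hmean : ∀ t, P[η t | 𝒢 t] =ᵐ[P] 0)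
    (hvar : ∀ t, P[fun ω => η t ω ^ 2 | 𝒢 t] ≤ᵐ[P] fun _ => σsq) :
    ∀ᵐ ω ∂P, ∃ z, Tendsto (fun n => ∑ t ∈ Finset.range n, c t ω * η t ω) atTop (𝓝 z) := by
  set N : ℕ → Ω → ℝ := fun n ω => ∑ t ∈ Finset.range n, c t ω * η t ω with hN
  have h𝒢' : ∀ t, 𝒢 t ≤ mΩ := fun t => (h𝒢 t).trans (ℱ.le _)
  have hcm : ∀ t, AEStronglyMeasurable (c t) P := fun t =>
    ((hc t).mono (h𝒢' t)).aestronglyMeasurable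
  have hcL : ∀ t, MemLp (c t) ⊤ P := fun t =>
    MemLp.of_bound (hcm t) C (Eventually.of_forall (hcC t))
  have hd : ∀ t, MemLp (c t * η t) 2 P := fun t => (hη2 t).mul (hcL t)
  have hNm : StronglyAdapted ℱ N := fun n => by
    refine Finset.stronglyMeasurable_fun_sum _ fun t ht => ?_
    have : t + 1 ≤ n := Finset.mem_range.1 ht
    exact (((hc t).mono (h𝒢 t)).mul (hη t)).mono (ℱ.mono this)
  have hN2 : ∀ n, MemLp (N n) 2 P := fun n => memLp_finsetSum _ fun t _ => hd t
  have hsucc : ∀ n ω, N (n + 1) ω = N n ω + c n ω * η n ω := fun n ω =>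
    Finset.sum_range_succ _ _
  -- In the application `𝒢 t` is the information after the state and message of period `t` but
  -- before its noise. The noise is orthogonal to everything known then, which gives both the
  -- martingale property and the vanishing cross terms.
  have hzero : ∀ t (f : Ω → ℝ), StronglyMeasurable[𝒢 t] f → MemLp f 2 P →
      P[f * η t | 𝒢 t] =ᵐ[P] 0 := fun t f hf hf2 => by
    filter_upwards [condExp_mul_of_stronglyMeasurable_left hf (hf2.integrable_mul (hη2 t))
      ((hη2 t).integrable one_le_two), hmean t] with ω h1 h2
    rw [h1, Pi.mul_apply, h2, Pi.zero_apply, mul_zero]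
  have hc2 : ∀ t, MemLp (c t) 2 P := fun t =>
    MemLp.of_bound (hcm t) C (Eventually.of_forall (hcC t))
  have hmart : Martingale N ℱ P := by
    refine martingale_of_condExp_sub_eq_zero_nat hNm
      (fun n => (hN2 n).integrable one_le_two) fun n => ?_
    have hsub : N (n + 1) - N n = c n * η n := by
      ext ω; simp [hsucc]
    rw [hsub]
    calc P[c n * η n | ℱ n] =ᵐ[P] P[P[c n * η n | 𝒢 n] | ℱ n] :=
          (condExp_condExp_of_le (hℱ𝒢 n) (h𝒢' n)).symm
      _ =ᵐ[P] P[(0 : Ω → ℝ) | ℱ n] := condExp_congr_ae (hzero n _ (hc n) (hc2 n))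
      _ = 0 := condExp_zero
  have hcross : ∀ n, ∫ ω, N n ω * c n ω * η n ω ∂P = 0 := fun n => by
    have hm : StronglyMeasurable[𝒢 n] (N n * c n) := ((hNm n).mono (hℱ𝒢 n)).mul (hc n)
    have h2 : MemLp (N n * c n) 2 P := (hcL n).mul (hN2 n)
    have := integral_congr_ae (hzero n _ hm h2)
    rw [integral_condExp (h𝒢' n)] at this
    simpa using this
  have hcsq : ∀ n, Integrable (fun ω => c n ω ^ 2) P := fun n => (hc2 n).integrable_sq
  have hsq : ∀ n, ∫ ω, (c n ω * η n ω) ^ 2 ∂P ≤ σsq * ∫ ω, c n ω ^ 2 ∂P := fun n => by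
    have hi : Integrable ((fun ω => c n ω ^ 2) * fun ω => η n ω ^ 2) P := by
      refine (hd n).integrable_sq.congr (Eventually.of_forall fun ω => ?_)
      simp [mul_pow]
    have hce : P[(fun ω => c n ω ^ 2) * fun ω => η n ω ^ 2 | 𝒢 n] =ᵐ[P]
        (fun ω => c n ω ^ 2) * P[fun ω => η n ω ^ 2 | 𝒢 n] := condExp_mul_of_stronglyMeasurable_left ((hc n).pow 2) hi (hη2 n).integrable_sq
    calc ∫ ω, (c n ω * η n ω) ^ 2 ∂P
        = ∫ ω, ((fun ω => c n ω ^ 2) * fun ω => η n ω ^ 2) ω ∂P := by simp [mul_pow]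
      _ = ∫ ω, (P[(fun ω => c n ω ^ 2) * fun ω => η n ω ^ 2 | 𝒢 n]) ω ∂P :=
          (integral_condExp (h𝒢' n)).symm
      _ ≤ ∫ ω, σsq * c n ω ^ 2 ∂P := by
          refine integral_mono_ae integrable_condExp ((hcsq n).const_mul _) ?_
          filter_upwards [hce, hvar n] with ω h1 h2
          rw [h1, mul_comm σsq]
          exact mul_le_mul_of_nonneg_left h2 (sq_nonneg _)
      _ = _ := integral_const_mul _ _
  -- Increments are orthogonal, so their second moments add.
  have hbound : ∀ n, ∫ ω, N n ω ^ 2 ∂P ≤ σsq * ∫ ω, ∑ t ∈ Finset.range n, c t ω ^ 2 ∂P := by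
    intro n
    rw [integral_finsetSum _ fun t _ => hcsq t]
    induction n with
    | zero => simp [hN]
    | succ n ih =>
      have hexp : ∀ ω, N (n + 1) ω ^ 2 =
          N n ω ^ 2 + 2 * (N n ω * c n ω * η n ω) + (c n ω * η n ω) ^ 2 := fun ω => by
        rw [hsucc]; ring
      have i2 : Integrable (fun ω => N n ω * c n ω * η n ω) P :=
        (((hcL n).mul (hN2 n) : MemLp (N n * c n) 2 P)).integrable_mul (hη2 n)
      have i3 : Integrable (fun ω => (c n ω * η n ω) ^ 2) P := (hd n).integrable_sq
      have i12 : Integrable (fun ω => N n ω ^ 2 + 2 * (N n ω * c n ω * η n ω)) P :=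
        (hN2 n).integrable_sq.add (i2.const_mul 2)
      simp only [hexp]
      rw [integral_add i12 i3, integral_add (hN2 n).integrable_sq (i2.const_mul 2),
        integral_const_mul, hcross, Finset.sum_range_succ, mul_add]
      linarith [hsq n]
  -- The second-moment bound gives an `L¹` bound through `|N| ≤ 1 + N ^ 2`, as martingale
  -- convergence requires. The absolute value appears because `σsq` is not assumed nonnegative.
  have hL1 : ∀ n, eLpNorm (N n) 1 P ≤ ((1 + |σsq| * B).toNNReal : NNReal) := fun n => by
    have hint := (hN2 n).integrable one_le_two
    rw [eLpNorm_one_eq_lintegral_enorm, ← ofReal_integral_norm_eq_lintegral_enorm hint]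
    refine ENNReal.ofReal_le_ofReal ?_
    have hsum0 : 0 ≤ ∫ ω, ∑ t ∈ Finset.range n, c t ω ^ 2 ∂P :=
      integral_nonneg fun ω => Finset.sum_nonneg fun t _ => sq_nonneg _
    have hsumB : ∫ ω, ∑ t ∈ Finset.range n, c t ω ^ 2 ∂P ≤ B := by
      calc _ ≤ ∫ _, B ∂P :=
            integral_mono (integrable_finsetSum _ fun t _ => hcsq t) (integrable_const _) (hcB n)
        _ = B := by simp
    calc ∫ ω, ‖N n ω‖ ∂P ≤ ∫ ω, (1 + N n ω ^ 2) ∂P := by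
          refine integral_mono hint.norm ((integrable_const _).add (hN2 n).integrable_sq)
            fun ω => ?_
          change |N n ω| ≤ 1 + N n ω ^ 2
          nlinarith [sq_abs (N n ω), sq_nonneg (|N n ω| - 1)]
      _ = 1 + ∫ ω, N n ω ^ 2 ∂P := by
          rw [integral_add (integrable_const _) (hN2 n).integrable_sq]; simp
      _ ≤ 1 + |σsq| * ∫ ω, ∑ t ∈ Finset.range n, c t ω ^ 2 ∂P := by
          linarith [hbound n, mul_le_mul_of_nonneg_right (le_abs_self σsq) hsum0]
      _ ≤ 1 + |σsq| * B := by gcongr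
  exact hmart.submartingale.exists_ae_tendsto_of_bdd hL1

section Run

variable {K : ℕ} {b : ℝ} {S : Schedule} {Q₀ : Table K} {Ω : Type*} {mΩ : MeasurableSpace Ω}
  {P : Measure Ω} {ℱ : Filtration ℕ mΩ} {X M : ℕ → Ω → Fin K} {η : ℕ → Ω → ℝ}

lemma IsBoltzmannRun.measurableSet_visit (h : IsBoltzmannRun b S Q₀ P ℱ X M η) (t : ℕ)
    (x m : Fin K) : MeasurableSet[ℱ (t + 1)] {ω | X t ω = x ∧ M t ω = m} :=
  (h.measurable_state t (measurableSet_singleton x)).inter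
    (h.measurable_message t (measurableSet_singleton m))

/-- Since `ε` decreases to `εlim`, each pair has conditional probability at least `εlim / K ^ 2` in
every period. These probabilities sum to infinity, and Lévy's conditional Borel–Cantelli lemma
applies. -/
lemma IsBoltzmannRun.ae_frequently_visit [IsProbabilityMeasure P]
    (h : IsBoltzmannRun b S Q₀ P ℱ X M η) {τlim εlim : ℝ} (hS : S.Admissible τlim εlim)
    (hε : 0 < εlim) (x m : Fin K) :
    ∀ᵐ ω ∂P, ∃ᶠ t in atTop, X t ω = x ∧ M t ω = m := by
  -- The visit of period `t` is known only at `ℱ (t + 1)`, hence the shifted index and the empty set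
  -- at zero.
  let s : ℕ → Set Ω := fun n => Nat.casesOn n ∅ fun t => {ω | X t ω = x ∧ M t ω = m}
  have hs : ∀ n, MeasurableSet[ℱ n] (s n) := fun n => by
    cases n with
    | zero => exact @MeasurableSet.empty _ (ℱ 0)
    | succ t => exact h.measurableSet_visit t x m
  have hK : (0 : ℝ) < K := Nat.cast_pos.2 x.pos
  have hcond := ae_all_iff.2 fun t => h.cond_law t x m
  filter_upwards [ae_mem_limsup_atTop_iff P hs, hcond] with ω hω hω'
  have hsum : Tendsto
      (fun n => ∑ k ∈ Finset.range n, P[(s (k + 1)).indicator (1 : Ω → ℝ) | ℱ k] ω) atTop atTop := by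
    have hlin : Tendsto (fun n : ℕ => (n : ℝ) * (1 / (K : ℝ) * (εlim * (1 / (K : ℝ)))))
        atTop atTop := tendsto_natCast_atTop_atTop.atTop_mul_const (by positivity)
    refine tendsto_atTop_mono (fun n => ?_) hlin
    have hge := Finset.card_nsmul_le_sum (Finset.range n)
      (fun k => P[(s (k + 1)).indicator (1 : Ω → ℝ) | ℱ k] ω) (1 / (K : ℝ) * (εlim * (1 / (K : ℝ))))
      fun k _ => by
        refine le_trans ?_ (hω' k).ge
        refine mul_le_mul_of_nonneg_left ?_ (by positivity)
        refine le_trans ?_ (le_explore (hS.ε_mem k).2.le (softmax_mem_strategies _ _) x m)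
        exact mul_le_mul_of_nonneg_right (hS.ε_antitone.le_of_tendsto hS.ε_lim k) (by positivity)
    simpa using hge
  have hmem := hω.2 hsum
  rw [mem_limsup_iff_frequently_mem, frequently_atTop] at hmem
  refine frequently_atTop.2 fun a => ?_
  obtain ⟨n, hn, hns⟩ := hmem (a + 1)
  obtain ⟨t, rfl⟩ : ∃ t, n = t + 1 := ⟨n - 1, by omega⟩
  exact ⟨t, by omega, hns⟩

/-- The step size is random but predates the noise: the visit count is known before period `t`, and
the realized pair is in the enlarged σ-algebra. -/
lemma IsBoltzmannRun.stronglyMeasurable_stepSize (h : IsBoltzmannRun b S Q₀ P ℱ X M η) (t : ℕ)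
    (x m : Fin K) :
    StronglyMeasurable[ℱ t ⊔ MeasurableSpace.comap (fun ω => (X t ω, M t ω)) inferInstance]
      (fun ω => stepSize S (fun s => X s ω) (fun s => M s ω) x m t) := by
  have hvis : Measurable[ℱ t]
      (fun ω => visits (fun s => X s ω) (fun s => M s ω) t x m) := by
    simp only [visits, Finset.card_filter]
    refine Finset.measurable_fun_sum _ fun s hs => ?_
    exact Measurable.ite (ℱ.mono (Finset.mem_range.1 hs) _ (h.measurableSet_visit s x m))
      measurable_const measurable_const
  have hset : MeasurableSet[ℱ t ⊔ MeasurableSpace.comap (fun ω => (X t ω, M t ω)) inferInstance]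
      {ω | X t ω = x ∧ M t ω = m} := by
    refine (le_sup_right : _ ≤ ℱ t ⊔ _) _ ⟨{(x, m)}, measurableSet_singleton _, ?_⟩
    ext ω; simp
  refine Measurable.stronglyMeasurable ?_
  exact Measurable.ite hset
    ((measurable_from_nat (f := S.α)).comp (hvis.mono le_sup_left le_rfl)) measurable_const

lemma IsBoltzmannRun.ae_exists_tendsto_noise [IsProbabilityMeasure P]
    (h : IsBoltzmannRun b S Q₀ P ℱ X M η) {τlim εlim : ℝ} (hS : S.Admissible τlim εlim)
    (x m : Fin K) :
    ∀ᵐ ω ∂P, ∃ z, Tendsto (fun n => ∑ t ∈ Finset.range n,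
      stepSize S (fun s => X s ω) (fun s => M s ω) x m t * η t ω) atTop (𝓝 z) := by
  obtain ⟨σsq, hσ⟩ := h.noise_var
  refine ae_exists_tendsto_sum_mul (ℱ := ℱ) (C := S.α 0)
    (𝒢 := fun t => ℱ t ⊔ MeasurableSpace.comap (fun ω => (X t ω, M t ω)) inferInstance) (fun _ => le_sup_left) (fun t => ?_)
    (fun t => h.stronglyMeasurable_stepSize t x m)
    (fun t ω => ?_) (fun n ω => sum_sq_stepSize_le hS _ _ x m n)
    (fun t => (h.measurable_noise t).stronglyMeasurable) h.noise_memLp h.noise_mean hσ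
  · exact sup_le (ℱ.mono t.le_succ)
      ((h.measurable_state t).prodMk (h.measurable_message t)).comap_le
  · rw [abs_of_nonneg (stepSize_nonneg hS _ _ x m t)]
    exact stepSize_le hS _ _ x m t

end Run

end CheapTalk

theorem theorem1 (K : ℕ) (hK : 2 ≤ K) (b : ℝ) (ζ : ℝ) (hζ : 0 < ζ) :
    ∃ δ : ℝ, 0 < δ ∧ ∀ τlim εlim : ℝ, 0 < τlim → τlim < δ → 0 < εlim → εlim < δ →
      ∀ S : CheapTalk.Schedule, S.Admissible τlim εlim →
      ∀ (Q₀ : CheapTalk.Table K)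
        (Ω : Type*) (mΩ : MeasurableSpace Ω) (P : Measure Ω), IsProbabilityMeasure P →
      ∀ (ℱ : Filtration ℕ mΩ) (X M : ℕ → Ω → Fin K) (η : ℕ → Ω → ℝ),
        CheapTalk.IsBoltzmannRun b S Q₀ P ℱ X M η →
        ∀ᵐ ω ∂P, ∀ μstar : CheapTalk.Table K,
          CheapTalk.limitSet (CheapTalk.policyPath b S Q₀
            (fun t => X t ω) (fun t => M t ω) (fun t => η t ω)) = {μstar} →
          ∃ μ' ∈ CheapTalk.NECS K b, μstar ∈ CheapTalk.stratBall ζ μ' := by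
  obtain ⟨δ, hδ, hnear⟩ := CheapTalk.exists_softmax_fixed_points_near_NECS K b hζ
  refine ⟨δ, hδ, ?_⟩
  intro τlim εlim hτ0 hτ hε0 hε S hS Q₀ Ω mΩ P hP ℱ X M η hrun
  -- There are finitely many pairs, so one null set serves them all, and it is fixed before `μstar`.
  have hvis := ae_all_iff.2 fun x => ae_all_iff.2 fun m => hrun.ae_frequently_visit hS hε0 x m
  have hnoise := ae_all_iff.2 fun x => ae_all_iff.2 fun m => hrun.ae_exists_tendsto_noise hS x m
  filter_upwards [hvis, hnoise] with ω h1 h2 μstar hμ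
  exact hnear τlim εlim hτ0 hτ hε0 hε μstar (CheapTalk.limit_eq_softmax hS hτ0 hε0 h1 h2 hμ)
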